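/- For integers $m\ge 3$ let $\mathcal P_m=\left\{\frac{(m-2)x^2-(m-4)x}{2} : x\in\mathbb Z,\ x\ge 0\right\}$ be the set of $m$-gonal numbers. For a vector $\mathbf a=(a_1,\dots,a_k)$ of positive integers, the sum of $m$-gonal numbers $(\mathcal P_m,\mathbf a)$ is called tight $\mathcal T(n)$-universal if $$\{a_1s_1+\cdots+a_ks_k : s_1,\dots,s_k\in\mathcal P_m\}\setminus\{0\}=\mathcal T(n):=\{N\in\mathbb Z : N\ge n\},$$ and it is called new if, moreover, $(\mathcal P_m,\mathbf b)$ is not tight $\mathcal T(n)$-universal for any proper subsequence $\mathbf b$ of $\mathbf a$. Let $m\ge 3$ and $n\ge 2m+3$ be integers. Then, up to reordering the entries of $\mathbf a$, there are exactly two new tight $\mathcal T(n)$-universal sums of $m$-gonal numbers $(\mathcal P_m,\mathbf a)$, namely those with $$\mathbf a=\mathbf x_n=(n,n,n+1,n+2,\dots,2n-1)\quad\text{and}\quad \mathbf a=\mathbf y_n=(n,n+1,n+2,\dots,2n).$$ That is, $\mathbf x_n$ and $\mathbf y_n$ are not rearrangements of each other, and $(\mathcal P_m,\mathbf a)$ is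 new tight $\mathcal T(n)$-universal if and only if $\mathbf a$ is a rearrangement of $\mathbf x_n$ or of $\mathbf y_n$. -/

import Mathlib

namespace PolygonalSums

/-- The set of `m`-gonal numbers: all `((m - 2) x² - (m - 4) x) / 2` with `x` a nonnegative integer
(the division is carried out in `ℚ`; the values are natural numbers for `m ≥ 3`). -/
def polygonalNumbers (m : ℕ) : Set ℕ :=
  {N | ∃ x : ℕ, (N : ℚ) = (((m : ℚ) - 2) * (x : ℚ) ^ 2 - ((m : ℚ) - 4) * (x : ℚ)) / 2}

/-- `V_S(a) = {a₁ s₁ + ⋯ + a_k s_k : s_i ∈ S}` for a vector `a = (a₁, …, a_k)`. -/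
def V (S : Set ℕ) (a : List ℕ) : Set ℕ :=
  {N | ∃ s : Fin a.length → ℕ, (∀ i, s i ∈ S) ∧ N = ∑ i, a.get i * s i}

/-- `V'_S(a) = V_S(a) \ {0}`. -/
def V' (S : Set ℕ) (a : List ℕ) : Set ℕ := V S a \ {0}

/-- `T(n)`: the set of integers greater than or equal to `n`. -/
def T (n : ℕ) : Set ℕ := {N | n ≤ N}

/-- `b ≺ a`: `b` is a proper subsequence of `a`. -/
def ProperSubseq (b a : List ℕ) : Prop := b.Sublist a ∧ b ≠ a

/-- `a` is a vector of positive integers and the sum of `m`-gonal numbers `(P_m, a)` is tight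
`T(n)`-universal. -/
def IsTightUniversal (m n : ℕ) (a : List ℕ) : Prop :=
  (∀ c ∈ a, 0 < c) ∧ V' (polygonalNumbers m) a = T n

/-- `(P_m, a)` is a new tight `T(n)`-universal sum of `m`-gonal numbers. -/
def IsNewTightUniversal (m n : ℕ) (a : List ℕ) : Prop :=
  IsTightUniversal m n a ∧ ∀ b : List ℕ, ProperSubseq b a → ¬ IsTightUniversal m n b

/-- `x_n = (n, n, n + 1, n + 2, …, 2n - 1)`. -/
def xVec (n : ℕ) : List ℕ := n :: List.range' n n

/-- `y_n = (n, n + 1, n + 2, …, 2n)`. -/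
def yVec (n : ℕ) : List ℕ := List.range' n (n + 1)

end PolygonalSums

/-! The multipliers available are 0, 1 and numbers at least 3. If all entries are at least n, a
nonzero represented number below 2n is therefore an entry, and 2n is an entry or n + n. So a tight
universal vector contains n, ..., 2n - 1 together with 2n or a second n, that is, `yVec n` or `xVec
n` (`IsTightUniversal.subperm`). Both have n + 1 entries, so once they are universal they are
precisely the minimal vectors.

Universality comes from pairing the entries i and c - i, with c = 3n for `yVec n` and c = 3n - 1 for
the run inside `xVec n`. Equal multipliers on each pair give c times a sum of m-gonal numbers, so by
Fermat's polygonal number theorem m pairs give every multiple of c; a few other entries, used once,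
supply the residue modulo c (`exists_sum_eq_mul_add`). The bound 2m + 3 ≤ n leaves enough pairs.

Fermat's theorem follows Cauchy: it reduces to three squares for 8k + 3, obtained from Dirichlet's
theorem, reciprocity and reduction of ternary forms. -/

/-! ### Ternary forms and sums of three squares. -/

/-- A positive definite integral ternary Gram matrix of determinant `1` is the Gram matrix of three
integer vectors. -/
theorem exists_gram_of_det_eq_one (A E : ℕ) : ∀ a b c r s t : ℤ, a = A → a * b - t ^ 2 = E →
    0 < a → 0 < a * b - t ^ 2 →
    a * b * c + 2 * r * s * t - a * r ^ 2 - b * s ^ 2 - c * t ^ 2 = 1 →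
    ∃ p₁ p₂ p₃ q₁ q₂ q₃ w₁ w₂ w₃ : ℤ,
      p₁ ^ 2 + p₂ ^ 2 + p₃ ^ 2 = a ∧ q₁ ^ 2 + q₂ ^ 2 + q₃ ^ 2 = b ∧
      w₁ ^ 2 + w₂ ^ 2 + w₃ ^ 2 = c ∧ q₁ * w₁ + q₂ * w₂ + q₃ * w₃ = r ∧
      p₁ * w₁ + p₂ * w₂ + p₃ * w₃ = s ∧ p₁ * q₁ + p₂ * q₂ + p₃ * q₃ = t := by
  induction A using Nat.strong_induction_on generalizing E with
  | _ A ihA =>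
  induction E using Nat.strong_induction_on with
  | _ E ihE =>
  have reduce : ∀ x y : ℤ, 0 < y → ∃ k : ℤ, 2 * |x + k * y| ≤ y := by
    intro x y hy
    refine ⟨-((2 * x + y) / (2 * y)), ?_⟩
    have h1 := Int.emod_add_mul_ediv (2 * x + y) (2 * y)
    have h2 := Int.emod_nonneg (2 * x + y) (by positivity : 2 * y ≠ 0)
    have h3 := Int.emod_lt_of_pos (2 * x + y) (by positivity : 0 < 2 * y)
    set z := (2 * x + y) / (2 * y)
    rcases abs_cases (x + -z * y) with ⟨h, _⟩ | ⟨h, _⟩ <;> rw [h] <;> nlinarith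
  have reduced : ∀ a b c r s t : ℤ, a = A → a * b - t ^ 2 = E → 0 < a → 0 < a * b - t ^ 2 →
      a * b * c + 2 * r * s * t - a * r ^ 2 - b * s ^ 2 - c * t ^ 2 = 1 →
      2 * |t| ≤ a → 2 * |a * r - s * t| ≤ a * b - t ^ 2 →
      ∃ p₁ p₂ p₃ q₁ q₂ q₃ w₁ w₂ w₃ : ℤ,
        p₁ ^ 2 + p₂ ^ 2 + p₃ ^ 2 = a ∧ q₁ ^ 2 + q₂ ^ 2 + q₃ ^ 2 = b ∧
        w₁ ^ 2 + w₂ ^ 2 + w₃ ^ 2 = c ∧ q₁ * w₁ + q₂ * w₂ + q₃ * w₃ = r ∧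
        p₁ * w₁ + p₂ * w₂ + p₃ * w₃ = s ∧ p₁ * q₁ + p₂ * q₂ + p₃ * q₃ = t := by
    intro a b c r s t hA hE ha he hdet ht hh
    have hb : 0 < b := by
      by_contra hb
      nlinarith [sq_nonneg t]
    have hcomp : (a * b - t ^ 2) * (a * c - s ^ 2) - (a * r - s * t) ^ 2 = a := by
      linear_combination a * hdet
    have hg : 0 < a * c - s ^ 2 := by
      by_contra hg
      nlinarith [sq_nonneg (a * r - s * t)]
    -- Swapping the first two vectors lowers `a`; swapping the last two keeps `a` and lowers `a * b
    -- - t ^ 2`.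
    by_cases hba : b < a
    · obtain ⟨p₁, p₂, p₃, q₁, q₂, q₃, w₁, w₂, w₃, h1, h2, h3, h4, h5, h6⟩ :=
        ihA b.toNat (by omega) E b a c s r t (by omega) (by linarith) hb (by linarith)
          (by linarith)
      exact ⟨q₁, q₂, q₃, p₁, p₂, p₃, w₁, w₂, w₃, h2, h1, h3, h5, h4, by linarith⟩
    by_cases hge : a * c - s ^ 2 < a * b - t ^ 2
    · obtain ⟨p₁, p₂, p₃, q₁, q₂, q₃, w₁, w₂, w₃, h1, h2, h3, h4, h5, h6⟩ :=
        ihE (a * c - s ^ 2).toNat (by omega) a c b r t s hA (by omega) ha hg (by linarith)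
      exact ⟨p₁, p₂, p₃, w₁, w₂, w₃, q₁, q₂, q₃, h1, h3, h2, by linarith, h6, h5⟩
    have ht2 : 4 * t ^ 2 ≤ a ^ 2 := by
      rw [← sq_abs t]; nlinarith [abs_nonneg t]
    have hh2 : 4 * (a * r - s * t) ^ 2 ≤ (a * b - t ^ 2) ^ 2 := by
      rw [← sq_abs (a * r - s * t)]; nlinarith [abs_nonneg (a * r - s * t)]
    set e := a * b - t ^ 2 with hedef
    set g := a * c - s ^ 2
    -- Now `a ≤ b` and `e ≤ g`, and `e * g - (a * r - s * t) ^ 2 = a`. The two resulting bounds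
    -- force `a = e = 1`.
    have h1 : 3 * a ^ 2 ≤ 4 * e := by nlinarith
    have h2 : 3 * e ^ 2 ≤ 4 * a := by nlinarith
    have ha1 : a = 1 := by
      by_contra hne
      have : 2 ≤ a := by omega
      nlinarith [mul_self_nonneg (a - 2)]
    have he1 : e = 1 := by nlinarith
    have ht0 : t = 0 := by
      have := abs_nonneg t
      exact abs_eq_zero.mp (by omega)
    have hh0 : a * r - s * t = 0 := by
      have := abs_nonneg (a * r - s * t)
      exact abs_eq_zero.mp (by omega)
    subst ht0
    subst ha1
    have hr : r = 0 := by linarith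
    subst hr
    have hb1 : b = 1 := by linarith
    subst hb1
    -- The entry `s` was never reduced; the determinant gives `c = s ^ 2 + 1`.
    exact ⟨1, 0, 0, 0, 1, 0, s, 0, 1, by norm_num, by norm_num, by linarith, by ring, by ring,
      by ring⟩
  intro a b c r s t hA hE ha he hdet
  -- Replace q by q + k p, then w by w + l q; neither changes `a`, `a * b - t ^ 2` or the
  -- determinant.
  obtain ⟨k, hk⟩ := reduce t a ha
  obtain ⟨l, hl⟩ := reduce (a * r - s * t) (a * b - t ^ 2) he
  have he' : a * (b + 2 * k * t + k ^ 2 * a) - (t + k * a) ^ 2 = a * b - t ^ 2 := by ring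
  obtain ⟨p₁, p₂, p₃, q₁, q₂, q₃, w₁, w₂, w₃, h1, h2, h3, h4, h5, h6⟩ :=
    reduced a (b + 2 * k * t + k ^ 2 * a)
      (c + 2 * l * (r + k * s) + l ^ 2 * (b + 2 * k * t + k ^ 2 * a))
      (r + k * s + l * (b + 2 * k * t + k ^ 2 * a)) (s + l * (t + k * a)) (t + k * a) hA
      (he'.trans hE) ha (he' ▸ he) (by linear_combination hdet) hk
      (by rw [he']; convert hl using 3; ring)
  refine ⟨p₁, p₂, p₃, q₁ - k * p₁, q₂ - k * p₂, q₃ - k * p₃, w₁ - l * q₁, w₂ - l * q₂,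
    w₃ - l * q₃, h1, ?_, ?_, ?_, ?_, ?_⟩
  · linear_combination h2 - 2 * k * h6 + k ^ 2 * h1
  · linear_combination h3 - 2 * l * h4 + l ^ 2 * h2
  · linear_combination h4 - l * h2 - k * h5 + k * l * h6
  · linear_combination h5 - l * h6
  · linear_combination h6 - k * h1

/-- If `-d` is a square modulo `d * n - 1`, then `n` is a sum of three squares. -/
theorem exists_sum_three_squares_of_dvd {n d x : ℤ} (hd : 0 < d) (hn : 2 ≤ n)
    (h : d * n - 1 ∣ x ^ 2 + d) : ∃ u v w : ℤ, u ^ 2 + v ^ 2 + w ^ 2 = n := by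
  obtain ⟨a, ha⟩ := h
  have hpos : 0 < d * n - 1 := by nlinarith
  have ha0 : 0 < a := by
    by_contra hneg
    nlinarith [sq_nonneg x]
  have hdet : a * (d * n - 1) - x ^ 2 = d := by linarith
  -- The Gram matrix has rows (a, x, 1), (x, dn - 1, 0), (1, 0, n), with determinant n d - (d n - 1)
  -- = 1.
  obtain ⟨_, _, _, _, _, _, u, v, w, -, -, h, -⟩ :=
    exists_gram_of_det_eq_one a.toNat d.toNat a (d * n - 1) n 0 1 x (by omega)
      (by omega) ha0 (by omega) (by linear_combination n * hdet)
  exact ⟨u, v, w, h⟩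

/-- Dirichlet's theorem gives a prime p with 2p = d n - 1 and d = 8v + 1. Since p ≡ 1 mod 4,
reciprocity turns (-d/p) into (p/d), which is 1 because 2p ≡ -1 mod d and d ≡ 1 mod 8. Thus -d is a
square modulo 2p. -/
theorem exists_sum_three_squares_of_mod_eight {n : ℕ} (hn : n % 8 = 3) :
    ∃ u v w : ℤ, u ^ 2 + v ^ 2 + w ^ 2 = n := by
  obtain ⟨k, rfl⟩ : ∃ k, n = 8 * k + 3 := ⟨n / 8, by omega⟩
  have hcop : Nat.Coprime (4 * k + 1) (4 * (8 * k + 3)) := by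
    refine Nat.Coprime.mul_right ?_ ?_
    · rw [Nat.coprime_mul_left_add_left]; norm_num
    · rw [show 8 * k + 3 = 1 + 2 * (4 * k + 1) by ring, Nat.coprime_add_mul_right_right]
      exact Nat.coprime_one_right _
  have : NeZero (4 * (8 * k + 3)) := ⟨by omega⟩
  obtain ⟨p, hpgt, hp, hpmod⟩ :=
    Nat.forall_exists_prime_gt_and_eq_mod ((ZMod.isUnit_iff_coprime _ _).mpr hcop) (4 * k + 1)
  obtain ⟨v, hv⟩ : ∃ v, p = 4 * k + 1 + 4 * (8 * k + 3) * v := by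
    have := (ZMod.natCast_eq_natCast_iff _ _ _).mp hpmod
    obtain ⟨v, hv⟩ := (Nat.modEq_iff_dvd' hpgt.le).mp this.symm
    exact ⟨v, by omega⟩
  have := Fact.mk hp
  have hp4 : p % 4 = 1 := by rw [hv, mul_assoc]; omega
  have hodd : Odd p := Nat.odd_iff.mpr (by omega)
  have hdodd : Odd (8 * v + 1) := Nat.odd_iff.mpr (by omega)
  have h2p : 2 * p + 1 = (8 * v + 1) * (8 * k + 3) := by rw [hv]; ring
  have hj1 : jacobiSym (2 * p : ℤ) (8 * v + 1) = 1 := by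
    have : (2 * p : ℤ) = -1 + (8 * v + 1 : ℕ) * (8 * k + 3) := by
      have := congrArg (Nat.cast (R := ℤ)) h2p
      push_cast at this ⊢
      linarith
    rw [this, jacobiSym.mod_left, Int.add_mul_emod_self_left, ← jacobiSym.mod_left,
      jacobiSym.at_neg_one hdodd, ZMod.χ₄_nat_one_mod_four (by omega)]
  have hj2 : jacobiSym 2 (8 * v + 1) = 1 := by
    rw [jacobiSym.at_two hdodd, ZMod.χ₈_nat_eq_if_mod_eight]
    simp only [show (8 * v + 1) % 2 = 1 by omega, show (8 * v + 1) % 8 = 1 by omega]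
    norm_num
  rw [jacobiSym.mul_left, hj2, one_mul] at hj1
  have hsq : legendreSym p (-(8 * v + 1 : ℕ)) = 1 := by
    rw [jacobiSym.legendreSym.to_jacobiSym, jacobiSym.neg _ hodd,
      ZMod.χ₄_nat_one_mod_four hp4, one_mul,
      jacobiSym.quadratic_reciprocity_one_mod_four' hdodd hp4, hj1]
  have hne : ((-(8 * v + 1 : ℕ) : ℤ) : ZMod p) ≠ 0 := by
    intro h0
    rw [(legendreSym.eq_zero_iff p _).mpr h0] at hsq
    exact zero_ne_one hsq
  obtain ⟨y, hy⟩ := (legendreSym.eq_one_iff p hne).mp hsq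
  obtain ⟨x₀, rfl⟩ := ZMod.intCast_surjective y
  have hx₀ : (p : ℤ) ∣ x₀ ^ 2 + (8 * v + 1) := by
    rw [← ZMod.intCast_zmod_eq_zero_iff_dvd]
    push_cast at hy ⊢
    linear_combination -hy
  -- Adding the odd prime p if necessary makes the root odd, which settles the factor 2.
  obtain ⟨x, hxp, hx2⟩ : ∃ x : ℤ, (p : ℤ) ∣ x ^ 2 + (8 * v + 1) ∧ 2 ∣ x ^ 2 + (8 * v + 1) := by
    rcases Int.even_or_odd x₀ with he | ho
    · refine ⟨x₀ + p, ?_, ?_⟩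
      · rw [show (x₀ + p) ^ 2 + (8 * v + 1) = x₀ ^ 2 + (8 * v + 1) + p * (2 * x₀ + p) by ring]
        exact dvd_add hx₀ (dvd_mul_right _ _)
      · have h1 : Odd (x₀ + (p : ℤ)) := he.add_odd (by exact_mod_cast hodd)
        exact even_iff_two_dvd.mp ((h1.pow).add_odd ⟨4 * v, by ring⟩)
    · exact ⟨x₀, hx₀, even_iff_two_dvd.mp ((ho.pow).add_odd ⟨4 * v, by ring⟩)⟩
  have hcop2 : IsCoprime (2 : ℤ) p := by
    have : Nat.Coprime 2 p := Nat.coprime_two_left.mpr hodd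
    exact_mod_cast Nat.isCoprime_iff_coprime.mpr this
  have hdvd := hcop2.mul_dvd hx2 hxp
  have h2p' := congrArg (Nat.cast (R := ℤ)) h2p
  push_cast at h2p' ⊢
  refine exists_sum_three_squares_of_dvd (d := 8 * v + 1) (x := x) (by positivity) (by omega) ?_
  rwa [← h2p', add_sub_cancel_right]

/-! ### Cauchy's lemma and the polygonal number theorem. -/

theorem two_mul_choose_two_add (x : ℕ) : 2 * x.choose 2 + x = x ^ 2 := by
  induction x with
  | zero => rfl
  | succ x ih =>
    rw [Nat.choose_succ_succ', Nat.choose_one_right]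
    linarith

theorem odd_of_sum_three_squares {u v w : ℤ} {N : ℤ} (h : u ^ 2 + v ^ 2 + w ^ 2 = 8 * N + 3) :
    Odd u ∧ Odd v ∧ Odd w := by
  have key : ∀ x : ℤ, (Even x ∧ (x ^ 2 % 8 = 0 ∨ x ^ 2 % 8 = 4)) ∨ (Odd x ∧ x ^ 2 % 8 = 1) := by
    intro x
    rcases Int.even_or_odd x with hx | hx
    · refine Or.inl ⟨hx, ?_⟩
      obtain ⟨y, rfl⟩ := hx
      have h1 : (y + y) ^ 2 = 4 * y ^ 2 := by ring
      omega
    · refine Or.inr ⟨hx, ?_⟩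
      obtain ⟨y, rfl⟩ := hx
      obtain ⟨z, hz⟩ := Int.even_mul_succ_self y
      have h1 : (2 * y + 1) ^ 2 = 4 * (y * (y + 1)) + 1 := by ring
      omega
  rcases key u with ⟨_, _⟩ | ⟨hu, _⟩ <;> rcases key v with ⟨_, _⟩ | ⟨hv, _⟩ <;>
    rcases key w with ⟨_, _⟩ | ⟨hw, _⟩ <;> first | exact ⟨hu, hv, hw⟩ | omega

/-- Gauss's theorem: every natural number is a sum of three triangular numbers. -/
theorem exists_sum_three_triangular (M : ℕ) :
    ∃ x y z : ℕ, (x.choose 2 + x) + (y.choose 2 + y) + (z.choose 2 + z) = M := by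
  obtain ⟨u, v, w, h⟩ := exists_sum_three_squares_of_mod_eight (n := 8 * M + 3) (by omega)
  push_cast at h
  have hodd := odd_of_sum_three_squares h
  have key : ∀ u : ℤ, Odd u → ∃ x : ℕ, u ^ 2 = 8 * (x.choose 2 + x : ℕ) + 1 := by
    intro u hu
    obtain ⟨x, hx⟩ := Int.natAbs_odd.mpr hu
    refine ⟨x, ?_⟩
    have := two_mul_choose_two_add x
    rw [← Int.natAbs_sq, hx]
    push_cast
    zify at this
    linear_combination -4 * this
  obtain ⟨x, hx⟩ := key u hodd.1
  obtain ⟨y, hy⟩ := key v hodd.2.1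
  obtain ⟨z, hz⟩ := key w hodd.2.2
  exact ⟨x, y, z, by omega⟩

/-- `A = ∑ xᵢ (xᵢ - 1) / 2` and `b = ∑ xᵢ` for four natural numbers `xᵢ`. -/
def IsChooseSum (A b : ℕ) : Prop :=
  ∃ x y z w : ℕ, x.choose 2 + y.choose 2 + z.choose 2 + w.choose 2 = A ∧ x + y + z + w = b

/-- Cauchy's lemma. -/
theorem isChooseSum_odd {A j : ℕ} (h₁ : 3 * A < 2 * j ^ 2 + j + 2) (h₂ : j ^ 2 ≤ 2 * A + j) :
    IsChooseSum A (2 * j + 1) := by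
  have hj := two_mul_choose_two_add j
  -- With b = 2j + 1, the numbers (b ± u ± v ± w) / 4, with an even number of minus signs, have sum
  -- b and satisfy 4 ∑ xᵢ² = b² + u² + v² + w². The required u² + v² + w² = 4(2A + b) - b² equals 8N
  -- + 3.
  obtain ⟨N, hN⟩ : ∃ N, A = N + j.choose 2 := ⟨A - j.choose 2, by omega⟩
  obtain ⟨u, v, w, h⟩ := exists_sum_three_squares_of_mod_eight (n := 8 * N + 3) (by omega)
  push_cast at h
  obtain ⟨hu, hv, hw⟩ := odd_of_sum_three_squares h
  obtain ⟨w, hw, h, h4⟩ : ∃ w : ℤ, Odd w ∧ u ^ 2 + v ^ 2 + w ^ 2 = 8 * N + 3 ∧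
      4 ∣ 2 * (j : ℤ) + 1 + u + v + w := by
    by_cases h4 : 4 ∣ 2 * (j : ℤ) + 1 + u + v + w
    · exact ⟨w, hw, h, h4⟩
    · refine ⟨-w, hw.neg, by rw [neg_sq]; exact h, ?_⟩
      obtain ⟨u, rfl⟩ := hu
      obtain ⟨v, rfl⟩ := hv
      obtain ⟨w, rfl⟩ := hw
      omega
  -- These numerators are multiples of 4, so exceeding -4 makes them nonnegative. By Cauchy–Schwarz
  -- this needs 3(8N + 3) < (b + 4)², which is exactly `h₁`.
  have hlt : ∀ e f : ℤ, e ^ 2 = 1 → f ^ 2 = 1 →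
      -4 < 2 * (j : ℤ) + 1 + e * u + f * v + e * f * w := by
    intro e f he hf
    have h1 : (e * u + f * v + e * f * w) ^ 2 < (2 * (j : ℤ) + 1 + 4) ^ 2 := by
      have h2 : (e * u + f * v + e * f * w) ^ 2 ≤ 3 * (u ^ 2 + v ^ 2 + w ^ 2) := by
        have e1 : (e * u) ^ 2 = u ^ 2 := by rw [mul_pow, he, one_mul]
        have e2 : (f * v) ^ 2 = v ^ 2 := by rw [mul_pow, hf, one_mul]
        have e3 : (e * f * w) ^ 2 = w ^ 2 := by rw [mul_pow, mul_pow, he, hf, one_mul, one_mul]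
        rw [← e1, ← e2, ← e3]
        nlinarith [sq_nonneg (e * u - f * v), sq_nonneg (e * u - e * f * w),
          sq_nonneg (f * v - e * f * w)]
      rw [h] at h2
      zify at hj h₁ hN
      nlinarith
    have := (abs_lt_of_sq_lt_sq' h1 (by positivity)).1
    linarith
  have l1 := hlt 1 1 (by norm_num) (by norm_num)
  have l2 := hlt 1 (-1) (by norm_num) (by norm_num)
  have l3 := hlt (-1) 1 (by norm_num) (by norm_num)
  have l4 := hlt (-1) (-1) (by norm_num) (by norm_num)
  obtain ⟨x, hx⟩ : ∃ x : ℕ, 2 * (j : ℤ) + 1 + u + v + w = 4 * x :=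
    ⟨((2 * (j : ℤ) + 1 + u + v + w) / 4).toNat, by omega⟩
  obtain ⟨v', rfl⟩ := hv
  obtain ⟨w', rfl⟩ := hw
  obtain ⟨u', rfl⟩ := hu
  obtain ⟨y, hy⟩ : ∃ y : ℕ, (y : ℤ) = x - (v' + w' + 1) := ⟨(x - (v' + w' + 1)).toNat, by omega⟩
  obtain ⟨z, hz⟩ : ∃ z : ℕ, (z : ℤ) = x - (u' + w' + 1) := ⟨(x - (u' + w' + 1)).toNat, by omega⟩
  obtain ⟨t, ht⟩ : ∃ t : ℕ, (t : ℤ) = x - (u' + v' + 1) := ⟨(x - (u' + v' + 1)).toNat, by omega⟩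
  have hsum : x + y + z + t = 2 * j + 1 := by omega
  refine ⟨x, y, z, t, ?_, hsum⟩
  have hx2 := two_mul_choose_two_add x
  have hy2 := two_mul_choose_two_add y
  have hz2 := two_mul_choose_two_add z
  have ht2 := two_mul_choose_two_add t
  have hsq : (x : ℤ) ^ 2 + y ^ 2 + z ^ 2 + t ^ 2 = 2 * A + (2 * j + 1) := by
    rw [hy, hz, ht]
    zify at hj hN
    have hxj : (j : ℤ) = 2 * x - 2 - u' - v' - w' := by linarith
    rw [hN]
    have h5 : (j.choose 2 : ℤ) * 2 = j ^ 2 - j := by linarith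
    have h6 : (N : ℤ) * 2 = u' ^ 2 + u' + (v' ^ 2 + v') + (w' ^ 2 + w') := by linarith
    rw [hxj] at h5 ⊢
    linear_combination -h6 - h5
  zify at hx2 hy2 hz2 ht2 hsum ⊢
  linarith

theorem isChooseSum_even {A j : ℕ} (hj : 0 < j) (h₁ : 2 * j ^ 2 ≤ 3 * A + 3 * j)
    (h₂ : 2 * A < j ^ 2 + j) (h₃ : 3 * A + 1 < 2 * j ^ 2 + j) :
    IsChooseSum A (2 * j + 2) ∨ IsChooseSum (A + 1) (2 * j) := by
  -- `h₁` and `h₂` give 4j² ≤ 6A + 6j < 3j² + 9j, leaving a finite check.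
  have hj9 : j < 9 := by nlinarith
  interval_cases j
  · obtain rfl : A = 0 := by omega
    exact Or.inl ⟨1, 1, 1, 1, rfl, rfl⟩
  · obtain rfl | rfl : A = 1 ∨ A = 2 := by omega
    exacts [Or.inr ⟨0, 0, 2, 2, rfl, rfl⟩,
      Or.inl ⟨1, 1, 2, 2, rfl, rfl⟩]
  · obtain rfl | rfl | rfl : A = 3 ∨ A = 4 ∨ A = 5 := by omega
    exacts [Or.inr ⟨0, 1, 2, 3, rfl, rfl⟩,
      Or.inl ⟨2, 2, 2, 2, rfl, rfl⟩,
      Or.inl ⟨1, 2, 2, 3, rfl, rfl⟩]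
  · obtain rfl | rfl | rfl : A = 7 ∨ A = 8 ∨ A = 9 := by omega
    exacts [Or.inr ⟨0, 2, 2, 4, rfl, rfl⟩,
      Or.inl ⟨2, 2, 3, 3, rfl, rfl⟩,
      Or.inl ⟨1, 3, 3, 3, rfl, rfl⟩]
  · obtain rfl | rfl | rfl : A = 12 ∨ A = 13 ∨ A = 14 := by omega
    exacts [Or.inl ⟨3, 3, 3, 3, rfl, rfl⟩,
      Or.inl ⟨2, 3, 3, 4, rfl, rfl⟩,
      Or.inl ⟨2, 2, 4, 4, rfl, rfl⟩]
  · obtain rfl | rfl | rfl : A = 18 ∨ A = 19 ∨ A = 20 := by omega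
    exacts [Or.inl ⟨3, 3, 4, 4, rfl, rfl⟩,
      Or.inl ⟨2, 4, 4, 4, rfl, rfl⟩,
      Or.inl ⟨2, 3, 4, 5, rfl, rfl⟩]
  · obtain rfl | rfl : A = 26 ∨ A = 27 := by omega
    exacts [Or.inl ⟨3, 3, 5, 5, rfl, rfl⟩,
      Or.inl ⟨2, 4, 5, 5, rfl, rfl⟩]
  · obtain rfl : A = 35 := by omega
    exact Or.inr ⟨0, 4, 6, 6, rfl, rfl⟩

/-- The thresholds `j`, `j'` are the least indices meeting the upper bound on A in Cauchy's lemma,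
for A and A + 1. The final disjunction serves the single value k(A + 1) + 2j' that the odd sums up
to 2j' + 1 and k - 2 ones miss. -/
theorem isChooseSum_of_consecutive {A : ℕ} {j j' : ℕ}
    (hj : ∀ i, 3 * A < 2 * i ^ 2 + i + 2 ↔ j ≤ i)
    (hj' : ∀ i, 3 * (A + 1) < 2 * i ^ 2 + i + 2 ↔ j' ≤ i) :
    (∀ i, j ≤ i → i ≤ j' → IsChooseSum A (2 * i + 1)) ∧
      (IsChooseSum A (2 * j' + 2) ∨ IsChooseSum (A + 1) (2 * j') ∨ IsChooseSum A (2 * j' + 3)) := by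
  have hpos : 0 < j' := by
    by_contra h0
    have := (hj' 0).mpr (by omega)
    omega
  obtain ⟨l, rfl⟩ : ∃ l, j' = l + 1 := ⟨j' - 1, by omega⟩
  have hl : ¬ 3 * (A + 1) < 2 * l ^ 2 + l + 2 := by rw [hj']; omega
  have hl' := (hj' (l + 1)).mpr le_rfl
  have hle : l ^ 2 + l ≤ 2 * A := by
    rcases Nat.lt_or_ge l 2 with h | h
    · interval_cases l <;> omega
    · nlinarith
  refine ⟨fun i hi hi' => isChooseSum_odd ((hj i).mpr hi) ?_, ?_⟩
  · rcases Nat.eq_zero_or_pos i with rfl | hi0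
    · simp
    · obtain ⟨i, rfl⟩ : ∃ q, i = q + 1 := ⟨i - 1, by omega⟩
      have : i ≤ l := by omega
      nlinarith
  · by_cases h : 2 * A < (l + 1) ^ 2 + (l + 1)
    · exact (isChooseSum_even hpos (by nlinarith) h (by nlinarith)).imp_right Or.inl
    · refine Or.inr (Or.inr (isChooseSum_odd (j := l + 1 + 1) ?_ ?_)) <;> nlinarith

/-- The arithmetic core of Fermat's polygonal number theorem for `m`-gonal numbers with `m ≥ 5`,
where `k = m - 2`. -/
theorem exists_isChooseSum {k : ℕ} (hk : 3 ≤ k) {M : ℕ} (hM : 0 < M) :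
    ∃ A b r, IsChooseSum A b ∧ r + 2 ≤ k ∧ M = k * A + b + r := by
  have hex : ∀ A : ℕ, ∃ j, ∀ i, 3 * A < 2 * i ^ 2 + i + 2 ↔ j ≤ i := by
    intro A
    classical
    have h : ∃ j, 3 * A < 2 * j ^ 2 + j + 2 := ⟨3 * A, by nlinarith⟩
    refine ⟨Nat.find h, fun i => ⟨fun hi => Nat.find_min' h hi, fun hi => ?_⟩⟩
    have := Nat.find_spec h
    have := Nat.pow_le_pow_left hi 2
    omega
  choose j hj using hex
  have hj0 : j 0 = 0 := Nat.le_zero.mp ((hj 0 0).mp (by norm_num))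
  -- The intervals from kA + 2 j(A) + 1 to the next such value cover all positive integers, since
  -- the first starts at 1.
  obtain ⟨A, hA, hA'⟩ : ∃ A, k * A + (2 * j A + 1) ≤ M ∧
      M < k * (A + 1) + (2 * j (A + 1) + 1) := by
    by_contra! hcon
    have : ∀ A, k * A + (2 * j A + 1) ≤ M := by
      intro A
      induction A with
      | zero => rw [hj0]; omega
      | succ A ih => exact hcon A ih
    have := this M
    nlinarith
  obtain ⟨hodd, hlast⟩ := isChooseSum_of_consecutive (hj A) (hj (A + 1))
  have hmono : j A ≤ j (A + 1) := by
    rw [← hj]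
    have := (hj (A + 1) (j (A + 1))).mpr le_rfl
    omega
  rw [mul_add] at hA'
  obtain ⟨t, rfl⟩ := Nat.exists_eq_add_of_le hA
  by_cases h1 : 2 * j A + t ≤ 2 * j (A + 1)
  · exact ⟨A, 2 * (j A + t / 2) + 1, t % 2, hodd _ (by omega) (by omega), by omega, by omega⟩
  by_cases h2 : 2 * j A + t + 2 ≤ 2 * j (A + 1) + k
  · exact ⟨A, 2 * j (A + 1) + 1, 2 * j A + t - 2 * j (A + 1), hodd _ hmono le_rfl, by omega,
      by omega⟩
  -- Only M = k(A + 1) + 2 j(A + 1) remains.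
  rcases hlast with h | h | h
  · exact ⟨A, _, k - 2, h, by omega, by omega⟩
  · exact ⟨A + 1, _, 0, h, by omega, by rw [mul_add]; omega⟩
  · exact ⟨A, _, k - 3, h, by omega, by omega⟩

namespace PolygonalSums

theorem mem_polygonalNumbers {k N : ℕ} :
    N ∈ polygonalNumbers (k + 2) ↔ ∃ x : ℕ, N = k * x.choose 2 + x := by
  refine exists_congr fun x => ?_
  have h : (2 * (x.choose 2 : ℚ) + x) = x ^ 2 := by exact_mod_cast two_mul_choose_two_add x
  rw [show (((k + 2 : ℕ) : ℚ) - 2) * (x : ℚ) ^ 2 - (((k + 2 : ℕ) : ℚ) - 4) * (x : ℚ) =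
    2 * ((k * x.choose 2 + x : ℕ) : ℚ) by push_cast; linear_combination -(k : ℚ) * h]
  rw [mul_div_cancel_left₀ _ two_ne_zero, Nat.cast_inj]

/-- Fermat's polygonal number theorem. -/
theorem exists_sum_polygonalNumbers {m : ℕ} (hm : 3 ≤ m) (M : ℕ) :
    ∃ l : List ℕ, (∀ s ∈ l, s ∈ polygonalNumbers m) ∧ l.length = m ∧ l.sum = M := by
  obtain ⟨k, rfl⟩ : ∃ k, m = k + 2 := ⟨m - 2, by omega⟩
  simp only [mem_polygonalNumbers]
  have hk : k = 1 ∨ k = 2 ∨ 3 ≤ k := by omega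
  rcases hk with rfl | rfl | hk
  · obtain ⟨x, y, z, h⟩ := exists_sum_three_triangular M
    refine ⟨[x.choose 2 + x, y.choose 2 + y, z.choose 2 + z], ?_, rfl, ?_⟩
    · simp only [one_mul, List.mem_cons, List.not_mem_nil, or_false]
      rintro s (rfl | rfl | rfl) <;> exact ⟨_, rfl⟩
    · simpa [add_assoc] using h
  · obtain ⟨x, y, z, w, h⟩ := Nat.sum_four_squares M
    refine ⟨[x ^ 2, y ^ 2, z ^ 2, w ^ 2], ?_, rfl, ?_⟩
    · simp only [two_mul_choose_two_add, List.mem_cons, List.not_mem_nil, or_false]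
      rintro s (rfl | rfl | rfl | rfl) <;> exact ⟨_, rfl⟩
    · simpa [add_assoc] using h
  · rcases Nat.eq_zero_or_pos M with rfl | hM
    · refine ⟨List.replicate (k + 2) 0, fun s hs => ⟨0, ?_⟩, by simp, by simp⟩
      simpa using List.eq_of_mem_replicate hs
    obtain ⟨A, b, r, ⟨x, y, z, w, hA, hb⟩, hr, hM⟩ := exists_isChooseSum hk hM
    refine ⟨[k * x.choose 2 + x, k * y.choose 2 + y, k * z.choose 2 + z, k * w.choose 2 + w] ++
      (List.replicate r 1 ++ List.replicate (k - 2 - r) 0), ?_, ?_, ?_⟩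
    · simp only [List.mem_append, List.mem_cons, List.not_mem_nil, or_false,
        List.mem_replicate]
      rintro s ((rfl | rfl | rfl | rfl) | ⟨-, rfl⟩ | ⟨-, rfl⟩)
      exacts [⟨_, rfl⟩, ⟨_, rfl⟩, ⟨_, rfl⟩, ⟨_, rfl⟩, ⟨1, by simp⟩, ⟨0, by simp⟩]
    · simp only [List.length_append, List.length_cons, List.length_nil, List.length_replicate]
      omega
    · simp only [List.sum_append, List.sum_cons, List.sum_nil, List.sum_replicate, smul_eq_mul]
      rw [hM, ← hA, ← hb]
      ring

end PolygonalSums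

/-! ### Values represented by a vector. -/

namespace PolygonalSums

variable {m : ℕ}

theorem zero_mem_polygonalNumbers (hm : 3 ≤ m) : 0 ∈ polygonalNumbers m := by
  obtain ⟨k, rfl⟩ : ∃ k, m = k + 2 := ⟨m - 2, by omega⟩
  exact mem_polygonalNumbers.mpr ⟨0, by simp⟩

theorem one_mem_polygonalNumbers (hm : 3 ≤ m) : 1 ∈ polygonalNumbers m := by
  obtain ⟨k, rfl⟩ : ∃ k, m = k + 2 := ⟨m - 2, by omega⟩
  exact mem_polygonalNumbers.mpr ⟨1, by simp⟩

theorem two_notMem_polygonalNumbers (hm : 3 ≤ m) : 2 ∉ polygonalNumbers m := by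
  obtain ⟨k, rfl⟩ : ∃ k, m = k + 2 := ⟨m - 2, by omega⟩
  rw [mem_polygonalNumbers]
  rintro ⟨x, hx⟩
  have h2 : 2 ≤ x := by
    by_contra! h
    interval_cases x <;> simp at hx
  have := Nat.choose_pos h2
  nlinarith

section Combination

variable {S : Set ℕ}

theorem mem_V_nil {N : ℕ} : N ∈ V S [] ↔ N = 0 := by
  simp [V]

theorem mem_V_cons {c N : ℕ} {a : List ℕ} :
    N ∈ V S (c :: a) ↔ ∃ s ∈ S, ∃ N' ∈ V S a, N = c * s + N' := by
  constructor
  · rintro ⟨s, hs, rfl⟩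
    exact ⟨s 0, hs 0, ∑ i : Fin a.length, a.get i * s i.succ, ⟨_, fun i => hs _, rfl⟩,
      Fin.sum_univ_succ fun i : Fin (a.length + 1) => (c :: a).get i * s i⟩
  · rintro ⟨s, hs, _, ⟨t, ht, rfl⟩, rfl⟩
    refine ⟨Fin.cons s t, fun i => ?_, ?_⟩
    · refine Fin.cases ?_ (fun i => ?_) i
      · exact hs
      · exact ht i
    · exact (Fin.sum_univ_succ fun i : Fin (a.length + 1) =>
        (c :: a).get i * (Fin.cons s t : Fin (a.length + 1) → ℕ) i).symm

theorem V_perm {a b : List ℕ} (h : a.Perm b) : V S a = V S b := by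
  induction h with
  | nil => rfl
  | cons c _ ih => ext N; simp only [mem_V_cons, ih]
  | swap c d l =>
    ext N
    simp only [mem_V_cons]
    constructor <;>
    · rintro ⟨s, hs, _, ⟨t, ht, N', hN', rfl⟩, rfl⟩
      exact ⟨t, ht, _, ⟨s, hs, N', hN', rfl⟩, by ring⟩
  | trans _ _ ih₁ ih₂ => exact ih₁.trans ih₂

theorem IsTightUniversal.perm {n : ℕ} {a b : List ℕ} (ha : IsTightUniversal m n a)
    (h : a.Perm b) : IsTightUniversal m n b :=
  ⟨fun c hc => ha.1 c (h.mem_iff.mpr hc), by rw [V', ← V_perm h]; exact ha.2⟩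

theorem sum_map_mul_mem_V {s : ℕ → ℕ} (hs : ∀ i, s i ∈ S) (a : List ℕ) :
    (a.map fun i => i * s i).sum ∈ V S a := by
  induction a with
  | nil => exact mem_V_nil.mpr rfl
  | cons c a ih => exact mem_V_cons.mpr ⟨s c, hs c, _, ih, by simp⟩

theorem sum_Ico_mul_mem_V {s : ℕ → ℕ} (hs : ∀ i, s i ∈ S) (n k : ℕ) :
    ∑ i ∈ Finset.Ico n (n + k), i * s i ∈ V S (List.range' n k) := by
  rw [show ∑ i ∈ Finset.Ico n (n + k), i * s i = ((List.range' n k).map fun i => i * s i).sum by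
    rw [← List.sum_toFinset _ List.nodup_range']
    congr 1
    ext i
    simp [List.mem_range'_1]]
  exact sum_map_mul_mem_V hs _

/-- A multiplier at least 3 already contributes 3n, and two nonzero terms contribute at least 2n,
with equality only for n + n. -/
theorem mem_of_mem_V {a : List ℕ} {n N : ℕ} (h2 : 2 ∉ S) (ha : ∀ c ∈ a, n ≤ c) (hN : N ∈ V S a) :
    N = 0 ∨ n ≤ N ∧ (N < 2 * n → N ∈ a) ∧ (N = 2 * n → N ∈ a ∨ 2 ≤ a.count n) := by
  induction a generalizing N with
  | nil => exact Or.inl (mem_V_nil.mp hN)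
  | cons c a ih =>
    obtain ⟨s, hs, N', hN', rfl⟩ := mem_V_cons.mp hN
    have hc : n ≤ c := ha c (by simp)
    have ih := ih (fun d hd => ha d (by simp [hd])) hN'
    have hs2 : s ≠ 2 := fun h => h2 (h ▸ hs)
    obtain rfl | rfl | hs3 : s = 0 ∨ s = 1 ∨ 3 ≤ s := by omega
    · rw [mul_zero, zero_add]
      refine ih.imp_right fun ⟨h1, h2, h3⟩ => ⟨h1, fun h => List.mem_cons_of_mem _ (h2 h), ?_⟩
      exact fun h => (h3 h).imp (List.mem_cons_of_mem _)
        fun h => h.trans (List.count_le_count_cons ..)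
    · rw [mul_one]
      rcases ih with rfl | ⟨h1, h2, -⟩
      · exact Or.inr ⟨hc, fun _ => by simp, fun _ => by simp⟩
      · rcases Nat.eq_zero_or_pos n with rfl | hn
        · rcases Nat.eq_zero_or_pos (c + N') with h0 | h0
          · exact Or.inl h0
          · exact Or.inr ⟨by omega, by omega, by omega⟩
        refine Or.inr ⟨by omega, by omega, fun h => Or.inr ?_⟩
        obtain rfl : c = n := by omega
        obtain rfl : N' = c := by omega
        have := List.count_pos_iff.mpr (h2 (by omega))
        rw [List.count_cons_self]
        omega
    · have : n * 3 ≤ c * s := Nat.mul_le_mul hc hs3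
      rcases Nat.eq_zero_or_pos (c * s + N') with h0 | h0
      · exact Or.inl h0
      · exact Or.inr ⟨by omega, by omega, by omega⟩

theorem exists_sum_eq_list_sum (h0 : 0 ∈ S) (l : List ℕ) (hl : ∀ s ∈ l, s ∈ S) (J : Finset ℕ)
    (hJ : l.length ≤ J.card) :
    ∃ t : ℕ → ℕ, (∀ i, t i ∈ S) ∧ (∀ i ∉ J, t i = 0) ∧ ∑ i ∈ J, t i = l.sum := by
  induction l generalizing J with
  | nil => exact ⟨0, fun _ => h0, fun _ _ => rfl, by simp⟩
  | cons c l ih =>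
    rw [List.length_cons] at hJ
    obtain ⟨j, hj⟩ := Finset.card_pos.mp (by omega : 0 < J.card)
    obtain ⟨t, h1, h2, h3⟩ := ih (fun s hs => hl s (by simp [hs])) (J.erase j)
      (by rw [Finset.card_erase_of_mem hj]; omega)
    refine ⟨Function.update t j c, fun i => ?_, fun i hi => ?_, ?_⟩
    · rcases eq_or_ne i j with rfl | hij
      · simpa using hl c (by simp)
      · simpa [hij] using h1 i
    · have hij : i ≠ j := fun h => hi (h ▸ hj)
      simpa [hij] using h2 i (by simp [hi])
    · rw [Finset.sum_update_of_mem hj, ← Finset.erase_eq, h3, List.sum_cons]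

end Combination

/-! ### Pairing coefficients, and universality of the two vectors. -/

/-- The coefficients `i` and `c - i`, taken with equal multipliers, represent the multiples of `c`,
and the coefficients in `U` are used once. -/
theorem exists_sum_eq_mul_add (hm : 3 ≤ m) {A U J : Finset ℕ} {c : ℕ} (hU : U ⊆ A)
    (hJ : ∀ i ∈ J, i ∈ A ∧ c - i ∈ A ∧ 2 * i < c) (hcard : m + (U.filter fun u => 2 * u ≠ c).card ≤ J.card) (M : ℕ) :
    ∃ s : ℕ → ℕ, (∀ i, s i ∈ polygonalNumbers m) ∧ ∑ i ∈ A, i * s i = c * M + ∑ i ∈ U, i := by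
  obtain ⟨l, hl, hlen, rfl⟩ := exists_sum_polygonalNumbers hm M
  set W := U.filter fun u => 2 * u ≠ c with hW
  -- Each element of `U` spoils at most one pair, indexed by its smaller member; c / 2 lies in no
  -- pair and costs nothing.
  set K := J \ W.image fun u => min u (c - u) with hK
  have hKcard : l.length ≤ K.card := by
    have h1 := Finset.le_card_sdiff (W.image fun u => min u (c - u)) J
    rw [← hK] at h1
    have h2 : (W.image fun u => min u (c - u)).card ≤ W.card := Finset.card_image_le
    omega
  have hKJ : ∀ i ∈ K, i ∈ J := fun i hi => (Finset.mem_sdiff.mp hi).1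
  have hKU : ∀ i ∈ K, i ∉ U ∧ c - i ∉ U := by
    intro i hi
    have h1 := (Finset.mem_sdiff.mp hi).2
    have h2 := (hJ i (hKJ i hi)).2.2
    simp only [hW, Finset.mem_image, Finset.mem_filter, not_exists, not_and, and_imp] at h1
    exact ⟨fun h => h1 i h (by omega) (by omega), fun h => h1 _ h (by omega) (by omega)⟩
  obtain ⟨t, ht, ht0, hsum⟩ :=
    exists_sum_eq_list_sum (zero_mem_polygonalNumbers hm) l hl K hKcard
  have hlow : ∀ i, t i ≠ 0 → i ∈ K := fun i hi => by_contra fun h => hi (ht0 i h)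
  have hlt : ∀ i ∈ K, 2 * i < c := fun i hi => (hJ i (hKJ i hi)).2.2
  refine ⟨fun i => if i ∈ U then 1 else if 2 * i < c then t i else if i ≤ c then t (c - i) else 0,
    fun i => ?_, ?_⟩
  · dsimp only
    split_ifs
    exacts [one_mem_polygonalNumbers hm, ht _, ht _, zero_mem_polygonalNumbers hm]
  have hsplit : ∀ i, i * (if i ∈ U then 1 else if 2 * i < c then t i else
      if i ≤ c then t (c - i) else 0) =
      (if i ∈ U then i else 0) + (if i ∈ K then i * t i else 0) +
        (if c - i ∈ K ∧ i ≤ c then i * t (c - i) else 0) := by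
    intro i
    by_cases hiU : i ∈ U
    · have h1 : i ∉ K := fun h => (hKU i h).1 hiU
      have h2 : ¬ (c - i ∈ K ∧ i ≤ c) := fun h => (hKU _ h.1).2 (by
        rwa [Nat.sub_sub_self h.2])
      simp [hiU, h1, h2]
    · rw [if_neg hiU, if_neg hiU, zero_add]
      by_cases hi : 2 * i < c
      · have h2 : ¬ (c - i ∈ K ∧ i ≤ c) := fun h => by have := hlt _ h.1; omega
        rw [if_pos hi, if_neg h2, add_zero]
        split_ifs with h
        · rfl
        · rw [ht0 i h, mul_zero]
      · have h2 : i ∉ K := fun h => hi (hlt i h)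
        rw [if_neg hi, if_neg h2, zero_add]
        by_cases hic : i ≤ c
        · simp only [hic, if_true, and_true]
          split_ifs with h
          · rfl
          · rw [ht0 _ h, mul_zero]
        · simp [hic]
  rw [Finset.sum_congr rfl fun i _ => hsplit i, Finset.sum_add_distrib, Finset.sum_add_distrib,
    ← Finset.sum_filter, ← Finset.sum_filter, ← Finset.sum_filter]
  have e1 : A.filter (· ∈ U) = U := by
    ext i
    simpa using @hU i
  have e2 : A.filter (· ∈ K) = K := by
    ext i
    simpa using fun h => (hJ i (hKJ i h)).1
  have e3 : ∑ i ∈ A.filter (fun i => c - i ∈ K ∧ i ≤ c), i * t (c - i) =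
      ∑ i ∈ K, (c - i) * t i := by
    refine Finset.sum_nbij' (fun i => c - i) (fun i => c - i) ?_ ?_ ?_ ?_ ?_
    · intro i hi
      exact (Finset.mem_filter.mp hi).2.1
    · intro i hi
      have := hlt i hi
      rw [Finset.mem_filter, Nat.sub_sub_self (by omega)]
      exact ⟨(hJ i (hKJ i hi)).2.1, hi, by omega⟩
    · intro i hi
      exact Nat.sub_sub_self (Finset.mem_filter.mp hi).2.2
    · intro i hi
      have := hlt i hi
      exact Nat.sub_sub_self (by omega)
    · intro i hi
      rw [Nat.sub_sub_self (Finset.mem_filter.mp hi).2.2]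
  rw [e1, e2, e3, add_assoc, ← Finset.sum_add_distrib, add_comm, ← hsum, Finset.mul_sum]
  congr 1
  refine Finset.sum_congr rfl fun i hi => ?_
  have := hlt i hi
  rw [← add_mul, Nat.add_sub_cancel' (by omega)]

variable {n : ℕ}

/-- A subset `U` of `[n, n + k)` together with multiples of `c`. -/
theorem mul_add_sum_mem_V_range' (hm : 3 ≤ m) {k c : ℕ} {U J : Finset ℕ}
    (hU : ∀ u ∈ U, n ≤ u ∧ u < n + k) (hJ : ∀ i ∈ J, n ≤ i ∧ c - i < n + k ∧ 2 * i < c)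
    (hcard : m + (U.filter fun u => 2 * u ≠ c).card ≤ J.card) (M : ℕ) :
    c * M + ∑ i ∈ U, i ∈ V (polygonalNumbers m) (List.range' n k) := by
  obtain ⟨s, hs, hsum⟩ := exists_sum_eq_mul_add hm (A := Finset.Ico n (n + k)) (c := c)
    (fun u hu => Finset.mem_Ico.mpr (hU u hu))
    (fun i hi => by
      have := hJ i hi
      simp only [Finset.mem_Ico]
      omega) hcard M
  rw [← hsum]
  exact sum_Ico_mul_mem_V hs n k

/-- With c = 3n there are ⌊(n + 1) / 2⌋ ≥ m + 2 pairs, so two entries may be spent on the residue.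
-/
theorem mem_V_yVec (hm : 3 ≤ m) (hn : 2 * m + 3 ≤ n) {N : ℕ} (hN : n ≤ N) :
    N ∈ V (polygonalNumbers m) (yVec n) := by
  have key : ∀ (M : ℕ) (U : Finset ℕ), (∀ u ∈ U, n ≤ u ∧ u ≤ 2 * n) → U.card ≤ 2 →
      3 * n * M + ∑ i ∈ U, i ∈ V (polygonalNumbers m) (yVec n) := by
    intro M U hU hcard
    refine mul_add_sum_mem_V_range' hm (J := Finset.Ico n (n + (n + 1) / 2)) ?_ ?_ ?_ M
    · intro u hu
      have := hU u hu
      omega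
    · intro i hi
      rw [Finset.mem_Ico] at hi
      omega
    · rw [Nat.card_Ico]
      have := Finset.card_filter_le U fun u => 2 * u ≠ 3 * n
      omega
  have hpair : ∀ M i j, n ≤ i → i < j → j ≤ 2 * n →
      3 * n * M + (i + j) ∈ V (polygonalNumbers m) (yVec n) := by
    intro M i j hi hij hj
    rw [← Finset.sum_pair (f := fun i => i) hij.ne]
    refine key M {i, j} ?_ Finset.card_le_two
    simp only [Finset.mem_insert, Finset.mem_singleton]
    omega
  have hdiv := Nat.div_add_mod N (3 * n)
  have hlt := Nat.mod_lt N (by omega : 0 < 3 * n)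
  set r := N % (3 * n)
  rcases Nat.eq_zero_or_pos r with h0 | h0
  · have := key (N / (3 * n)) ∅ (by simp) (by simp)
    rw [Finset.sum_empty, ← h0, hdiv] at this
    exact this
  by_cases h1 : r < n
  -- No one or two entries sum to r < n, so one multiple of 3n is borrowed: 3n + r = (n + r) + 2n.
  · obtain ⟨M, hM⟩ : ∃ M, N / (3 * n) = M + 1 := by
      refine Nat.exists_eq_succ_of_ne_zero fun h => ?_
      rw [h] at hdiv
      omega
    rw [hM, mul_add] at hdiv
    have := hpair M (n + r) (2 * n) (by omega) (by omega) (by omega)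
    rwa [show 3 * n * M + (n + r + 2 * n) = N by omega] at this
  by_cases h2 : r ≤ 2 * n
  · have := key (N / (3 * n)) {r} (by simpa using ⟨by omega, h2⟩) (by simp)
    rwa [Finset.sum_singleton, hdiv] at this
  · have := hpair (N / (3 * n)) n (r - n) le_rfl (by omega) (by omega)
    rwa [show n + (r - n) = r by omega, hdiv] at this

/-- With c = 3n - 1 there are ⌊n / 2⌋ pairs, at least m + 2 for even n but perhaps only m + 1 for
odd n. In the odd case c / 2 is an entry outside every pair, so a second entry is still affordable.
The additional n is free in all cases. -/
theorem mem_V_xVec (hm : 3 ≤ m) (hn : 2 * m + 3 ≤ n) {N : ℕ} (hN : n ≤ N) :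
    N ∈ V (polygonalNumbers m) (xVec n) := by
  have hcons : ∀ N' ∈ V (polygonalNumbers m) (List.range' n n),
      N' ∈ V (polygonalNumbers m) (xVec n) ∧ n + N' ∈ V (polygonalNumbers m) (xVec n) :=
    fun N' h => ⟨mem_V_cons.mpr ⟨0, zero_mem_polygonalNumbers hm, N', h, by simp⟩,
      mem_V_cons.mpr ⟨1, one_mem_polygonalNumbers hm, N', h, by simp⟩⟩
  have key : ∀ (M : ℕ) (U : Finset ℕ), (∀ u ∈ U, n ≤ u ∧ u < 2 * n) → 
      m + (U.filter fun u => 2 * u ≠ 3 * n - 1).card ≤ n / 2 →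
      (3 * n - 1) * M + ∑ i ∈ U, i ∈ V (polygonalNumbers m) (List.range' n n) := by
    intro M U hU hcard
    refine mul_add_sum_mem_V_range' hm (J := Finset.Ico n (n + n / 2)) ?_ ?_ ?_ M
    · intro u hu
      have := hU u hu
      omega
    · intro i hi
      rw [Finset.mem_Ico] at hi
      omega
    · rw [Nat.card_Ico]
      omega
  have hsingle : ∀ M i, n ≤ i → i < 2 * n →
      (3 * n - 1) * M + i ∈ V (polygonalNumbers m) (List.range' n n) := by
    intro M i hi hi'
    have := key M {i} (by simpa using ⟨hi, hi'⟩) (by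
      have := Finset.card_filter_le {i} fun u => 2 * u ≠ 3 * n - 1
      rw [Finset.card_singleton] at this
      omega)
    rwa [Finset.sum_singleton] at this
  have hpair : ∀ M i j, n ≤ i → i < 2 * n → n ≤ j → j < 2 * n → i ≠ j →
      n % 2 = 0 ∨ 2 * i = 3 * n - 1 →
      (3 * n - 1) * M + (i + j) ∈ V (polygonalNumbers m) (List.range' n n) := by
    intro M i j hi hi' hj hj' hij hpar
    rw [← Finset.sum_pair (f := fun i => i) hij]
    refine key M {i, j} ?_ ?_
    · simp only [Finset.mem_insert, Finset.mem_singleton]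
      omega
    · rcases hpar with hpar | hpar
      · have h1 := Finset.card_filter_le {i, j} fun u => 2 * u ≠ 3 * n - 1
        have h2 : ({i, j} : Finset ℕ).card ≤ 2 := Finset.card_le_two
        omega
      · have h1 := Finset.card_filter_le {j} fun u => 2 * u ≠ 3 * n - 1
        rw [Finset.filter_insert, if_neg (not_not.mpr hpar)]
        rw [Finset.card_singleton] at h1
        omega
  have hdiv := Nat.div_add_mod N (3 * n - 1)
  have hlt := Nat.mod_lt N (by omega : 0 < 3 * n - 1)
  set r := N % (3 * n - 1)
  rcases Nat.eq_zero_or_pos r with h0 | h0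
  · have := (hcons _ (key (N / (3 * n - 1)) ∅ (by simp) (by simp; omega))).1
    rw [Finset.sum_empty, ← h0, hdiv] at this
    exact this
  by_cases h1 : r < n
  · obtain ⟨M, hM⟩ : ∃ M, N / (3 * n - 1) = M + 1 := by
      refine Nat.exists_eq_succ_of_ne_zero fun h => ?_
      rw [h] at hdiv
      omega
    rw [hM, mul_add, mul_one] at hdiv
    rcases Nat.even_or_odd' n with ⟨h, hh | hh⟩
    -- For r = n - 1 the summands 2n - 1 and n + r would coincide.
    · by_cases hr : r + 1 = n
      · have := (hcons _ (hpair M n (2 * n - 2) le_rfl (by omega) (by omega) (by omega) (by omega)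
          (Or.inl (by omega)))).2
        rwa [show n + ((3 * n - 1) * M + (n + (2 * n - 2))) = N by omega] at this
      · have := (hcons _ (hpair M (2 * n - 1) (n + r) (by omega) (by omega) (by omega) (by omega)
          (by omega) (Or.inl (by omega)))).1
        rwa [show (3 * n - 1) * M + (2 * n - 1 + (n + r)) = N by omega] at this
    -- Here n + h = c / 2. Its companion n + h + r stays below 2n only for r ≤ h; beyond that the
    -- additional n is split off.
    · by_cases hr : r ≤ h
      · have := (hcons _ (hpair M (n + h) (n + h + r) (by omega) (by omega) (by omega) (by omega)
          (by omega) (Or.inr (by omega)))).1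
        rwa [show (3 * n - 1) * M + (n + h + (n + h + r)) = N by omega] at this
      · have := (hcons _ (hpair M (n + h) (h + r) (by omega) (by omega) (by omega) (by omega)
          (by omega) (Or.inr (by omega)))).2
        rwa [show n + ((3 * n - 1) * M + (n + h + (h + r))) = N by omega] at this
  by_cases h2 : r < 2 * n
  · have := (hcons _ (hsingle (N / (3 * n - 1)) r (by omega) h2)).1
    rwa [hdiv] at this
  · have := (hcons _ (hsingle (N / (3 * n - 1)) (r - n) (by omega) (by omega))).2
    rwa [add_left_comm, Nat.add_sub_cancel' (by omega), hdiv] at this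

theorem isTightUniversal_of_forall_mem (hm : 3 ≤ m) (hn : 0 < n) {a : List ℕ} (ha : ∀ c ∈ a, n ≤ c)
    (h : ∀ N, n ≤ N → N ∈ V (polygonalNumbers m) a) : IsTightUniversal m n a := by
  refine ⟨fun c hc => hn.trans_le (ha c hc), Set.ext fun N => ⟨fun hN => ?_, fun hN => ?_⟩⟩
  · exact ((mem_of_mem_V (two_notMem_polygonalNumbers hm) ha hN.1).resolve_left hN.2).1
  · exact ⟨h N hN, fun h0 => (hn.trans_le hN).ne' h0⟩

theorem isTightUniversal_xVec (hm : 3 ≤ m) (hn : 2 * m + 3 ≤ n) : IsTightUniversal m n (xVec n) := by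
  refine isTightUniversal_of_forall_mem hm (by omega) (fun c hc => ?_) fun N => mem_V_xVec hm hn
  rw [xVec, List.mem_cons, List.mem_range'_1] at hc
  omega

theorem isTightUniversal_yVec (hm : 3 ≤ m) (hn : 2 * m + 3 ≤ n) : IsTightUniversal m n (yVec n) := by
  refine isTightUniversal_of_forall_mem hm (by omega) (fun c hc => ?_) fun N => mem_V_yVec hm hn
  rw [yVec, List.mem_range'_1] at hc
  omega

/-! ### Minimality and classification. -/

theorem IsTightUniversal.subperm (hm : 3 ≤ m) (hn : 0 < n) {a : List ℕ}
    (ha : IsTightUniversal m n a) : (xVec n).Subperm a ∨ (yVec n).Subperm a := by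
  have hmem : ∀ N, N ∈ V (polygonalNumbers m) a ∧ N ≠ 0 ↔ n ≤ N := fun N => Set.ext_iff.mp ha.2 N
  have hself : ∀ c ∈ a, c ∈ V (polygonalNumbers m) a := by
    intro c hc
    rw [V_perm (List.perm_cons_erase hc)]
    refine mem_V_cons.mpr ⟨1, one_mem_polygonalNumbers hm, 0, ?_, by simp⟩
    simpa using sum_map_mul_mem_V (s := 0) (fun _ => zero_mem_polygonalNumbers hm) (a.erase c)
  have hle : ∀ c ∈ a, n ≤ c := fun c hc => (hmem c).mp ⟨hself c hc, (ha.1 c hc).ne'⟩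
  have hV : ∀ N, n ≤ N → (N < 2 * n → N ∈ a) ∧ (N = 2 * n → N ∈ a ∨ 2 ≤ a.count n) := by
    intro N hN
    obtain ⟨h1, h2⟩ := (hmem N).mpr hN
    exact ((mem_of_mem_V (two_notMem_polygonalNumbers hm) hle h1).resolve_left h2).2
  rcases (hV (2 * n) (by omega)).2 rfl with h | h
  · right
    refine List.subperm_of_subset List.nodup_range' fun i hi => ?_
    rw [yVec, List.mem_range'_1] at hi
    rcases (by omega : i < 2 * n ∨ i = 2 * n) with h1 | rfl
    exacts [(hV i hi.1).1 h1, h]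
  · left
    have hn_mem : n ∈ a := List.count_pos_iff.mp (by omega)
    refine ((List.subperm_cons n).mpr ?_).trans (List.perm_cons_erase hn_mem).symm.subperm
    refine List.subperm_of_subset List.nodup_range' fun i hi => ?_
    rw [List.mem_range'_1] at hi
    rcases eq_or_ne i n with rfl | hne
    · refine List.count_pos_iff.mp ?_
      rw [List.count_erase_self]
      omega
    · exact (List.mem_erase_of_ne hne).mpr ((hV i hi.1).1 (by omega))

theorem length_xVec : (xVec n).length = n + 1 := by simp [xVec]

theorem length_yVec : (yVec n).length = n + 1 := by simp [yVec]

/-- Every tight universal vector contains one of two vectors of length n + 1, so none is shorter. -/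
theorem IsTightUniversal.isNew (hm : 3 ≤ m) (hn : 0 < n) {a : List ℕ} (ha : IsTightUniversal m n a)
    (hlen : a.length = n + 1) : IsNewTightUniversal m n a := by
  refine ⟨ha, fun b hb htight => hb.2 (hb.1.eq_of_length_le ?_)⟩
  rw [hlen]
  rcases htight.subperm hm hn with h | h
  · exact length_xVec.symm.trans_le h.length_le
  · exact length_yVec.symm.trans_le h.length_le

theorem IsNewTightUniversal.perm_of_subperm {a b : List ℕ} (ha : IsNewTightUniversal m n a)
    (hb : IsTightUniversal m n b) (h : b.Subperm a) : a.Perm b := by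
  obtain ⟨l, hl, hla⟩ := h
  by_cases hne : l = a
  · exact hne ▸ hl
  · exact absurd (hb.perm hl.symm) (ha.2 l ⟨hla, hne⟩)

end PolygonalSums

theorem mainTheorem7 (m n : ℕ) (hm : 3 ≤ m) (hn : 2 * m + 3 ≤ n) :
    PolygonalSums.IsNewTightUniversal m n (PolygonalSums.xVec n) ∧
    PolygonalSums.IsNewTightUniversal m n (PolygonalSums.yVec n) ∧
    ¬ (PolygonalSums.xVec n).Perm (PolygonalSums.yVec n) ∧
    ∀ a : List ℕ, PolygonalSums.IsNewTightUniversal m n a ↔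
      (a.Perm (PolygonalSums.xVec n) ∨ a.Perm (PolygonalSums.yVec n)) := by
  open PolygonalSums in
  have hn0 : 0 < n := by omega
  have hx := isTightUniversal_xVec hm hn
  have hy := isTightUniversal_yVec hm hn
  refine ⟨hx.isNew hm hn0 length_xVec, hy.isNew hm hn0 length_yVec, fun h => ?_, fun a =>
    ⟨fun ha => ?_, ?_⟩⟩
  · have h1 : 2 * n ∈ yVec n := by
      rw [yVec, List.mem_range'_1]
      omega
    have h2 := h.mem_iff.mpr h1
    rw [xVec, List.mem_cons, List.mem_range'_1] at h2
    omega
  · exact (ha.1.subperm hm hn0).imp (ha.perm_of_subperm hx) (ha.perm_of_subperm hy)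
  · rintro (h | h)
    · exact (hx.perm h.symm).isNew hm hn0 (h.length_eq.trans length_xVec)
    · exact (hy.perm h.symm).isNew hm hn0 (h.length_eq.trans length_yVec)
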